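/- Let $\mathcal E$ be a finite-dimensional real inner product space, let $f:\mathcal E\to(-\infty,\infty]$ be convex and lower semicontinuous, with $\mathrm{dom}(f)=\{x: f(x)<\infty\}$ and $\mathrm{epi}(f)=\{(x,t)\in\mathcal E\times\mathbb R: f(x)\le t\}$. Let $S\subseteq\mathcal E$ be closed and convex, let $A$ be a linear map from $\mathcal E$ to a real vector space, let $b$ be a vector of that space, and put $\mathrm{Feas}=\{x\in S: Ax=b\}$. Let $\bar e\in\mathrm{int}(S\cap\mathrm{dom}(f))$ satisfy $A\bar e=b$, and assume that the set $\{x\in\mathrm{Feas}: f(x)\le f(\bar e)\}$ is bounded; denote its diameter by $\bar D$. Let $f^*=\inf_{x\in\mathrm{Feas}}f(x)$ (which is then finite), let $\hat f\in\mathbb R$ satisfy $\hat f>f(\bar e)$, and let $$\hat r=\sup\{r : \text{for all } x,\ \|x-\bar e\|\le r \text{ and } Ax=b \text{ imply } x\in S \text{ and } f(x)\le\hat f\}.$$ (If $\hat r=\infty$, then $\bar D=0$ and $\bar D/\hat r$ means $0$; if $\bar D/\hat r=0$, the right-hand side of the bound (1) below is read as $0$.) For $x\in\mathcal E$ and $t\in\mathbb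 R$ let $\alpha_1(x)=\sup\{a\in\mathbb R:\bar e+a(x-\bar e)\in S\}$, $\alpha_2(x,t)=\sup\{a\in\mathbb R: f(\bar e+a(x-\bar e))\le\hat f+a(t-\hat f)\}$, $\alpha(x,t)=\min\{\alpha_1(x),\alpha_2(x,t)\}$ (finite and positive if $Ax=b$ and $t<\hat f$), and $$\pi'(x,t)=(\bar e,\hat f)+\alpha(x,t)\,\big((x,t)-(\bar e,\hat f)\big).$$ Write $N_C(p)=\{v:\langle v,q-p\rangle\le0\ \forall q\in C\}$, where $\mathcal E\times\mathbb R$ carries the inner product $\langle x_1,x_2\rangle+t_1t_2$. Let $$G_1(x')=\Big\{\tfrac{-1}{\langle v,\bar e-x'\rangle}v: 0\ne v\in N_S(x')\Big\},\qquad G_2(x',t')=\Big\{\tfrac{-1}{\langle v,\bar e-x'\rangle+(\hat f-t')\delta}v: (0,0)\ne(v,\delta)\in N_{\mathrm{epi}(f)}(x',t')\Big\},$$ $\mathrm{bdy}_1=\{(x',t'): x'\in\mathrm{bdy}(S)\}$, $\mathrm{bdy}_2=\mathrm{bdy}(\mathrm{epi}(f))$, and let $G(x',t')$ be $G_1(x')$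 on $\mathrm{bdy}_1\setminus\mathrm{bdy}_2$, $G_2(x',t')$ on $\mathrm{bdy}_2\setminus\mathrm{bdy}_1$, and the convex hull of $G_1(x')\cup G_2(x',t')$ on $\mathrm{bdy}_1\cap\mathrm{bdy}_2$. Let $P$ be the orthogonal projection of $\mathcal E$ onto $\ker A$. Algorithm B, given $f^*$, $\bar e$ and $\hat f$, starts with $x_0=\bar e$, $(x_0',t_0')=(\bar e,f(\bar e))$, $\alpha_0=\alpha(x_0,f^*)$ and iterates, for $k=0,1,2,\dots$: choose any $g_k\in G(x_k',t_k')$ and let $$x_{k+1}=x_k+\frac{\alpha_k-1}{\alpha_k\|P(g_k)\|^2}P(g_k),\qquad (x_{k+1}',t_{k+1}')=\pi'(x_{k+1},f^*),\qquad \alpha_{k+1}=\alpha(x_{k+1},f^*),$$ where $x_{k+1}=x_k$ if $P(g_k)=0$ (which can happen only if $\alpha_k=1$). Then for every such sequence all points $x_k'$ lie in $\mathrm{Feas}\cap\mathrm{dom}(f)$, and for all $0<\epsilon<1$ and all integers $\ell\ge0$, $$\ell\ \ge\ 4\Big(\frac{\bar D}{\hat r}\Big)^2\Big(\frac43\Big(\frac{1-\epsilon}{\epsilon}\Big)^2+4\,\frac{1-\epsilon}{\epsilon}+\log_2\frac{1-\epsilon}{\epsilon}+\log_2\frac{\bar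 D}{\hat r}+1\Big)\tag{1}$$ implies $$\min_{0\le k\le\ell}\frac{f(x_k')-f^*}{\hat f-f^*}\ \le\ \epsilon .$$ -/

import Mathlib

open scoped RealInnerProductSpace

noncomputable section

namespace AlgorithmB

variable {E : Type*} [NormedAddCommGroup E] [InnerProductSpace ℝ E] [FiniteDimensional ℝ E]
variable {F : Type*} [AddCommGroup F] [Module ℝ F]

/-- Effective domain of an extended-valued function `f : E → (-∞, ∞]`. -/
def dom (f : E → EReal) : Set E := {x | f x ≠ ⊤}

/-- Epigraph `{(x, t) | f x ≤ t}`; here `t` is real, so `x ∈ dom f` is automatic. -/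
def epi (f : E → EReal) : Set (E × ℝ) := {p | f p.1 ≤ (p.2 : EReal)}

/-- Feasible region `{x ∈ S | A x = b}`. -/
def feas (S : Set E) (A : E →ₗ[ℝ] F) (b : F) : Set E := {x | x ∈ S ∧ A x = b}

/-- The sublevel set `{x ∈ Feas | f x ≤ f ē}`. -/
def sublevel (f : E → EReal) (S : Set E) (A : E →ₗ[ℝ] F) (b : F) (ebar : E) : Set E :=
  {x | x ∈ feas S A b ∧ f x ≤ f ebar}

/-- The diameter `D̄` of the sublevel set. -/
def Dbar (f : E → EReal) (S : Set E) (A : E →ₗ[ℝ] F) (b : F) (ebar : E) : ℝ :=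
  Metric.diam (sublevel f S A b ebar)

/-- The optimal value `f*`, i.e. the infimum of `f` over the feasible region, as a real number
(the infimum is finite under the hypotheses of the theorem). -/
def fstar (f : E → EReal) (S : Set E) (A : E →ₗ[ℝ] F) (b : F) : ℝ :=
  (⨅ x ∈ feas S A b, f x).toReal

/-- `r̂ = sup {r | ‖x - ē‖ ≤ r and A x = b imply x ∈ S and f x ≤ f̂}`.
When the sublevel set is bounded, this set of radii is unbounded only if `ker A = 0`; the only
point with `A x = b` is then `ē`, so `D̄ = 0` and the quotient `D̄ / r̂` is `0` either way. -/
def rhat (f : E → EReal) (S : Set E) (A : E →ₗ[ℝ] F) (b : F) (ebar : E) (fhat : ℝ) : ℝ :=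
  sSup {r : ℝ | ∀ x : E, ‖x - ebar‖ ≤ r → A x = b → x ∈ S ∧ f x ≤ (fhat : EReal)}

/-- `x(a) = ē + a (x - ē)`. -/
def lineX (ebar x : E) (a : ℝ) : E := ebar + a • (x - ebar)

/-- `t(a) = f̂ + a (t - f̂)`. -/
def lineT (fhat t : ℝ) (a : ℝ) : ℝ := fhat + a * (t - fhat)

/-- `α₁(x) = sup {a | x(a) ∈ S}`, possibly `∞`. -/
def alpha1 (S : Set E) (ebar x : E) : EReal :=
  sSup ((fun a : ℝ => (a : EReal)) '' {a : ℝ | lineX ebar x a ∈ S})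

/-- `α₂(x, t) = sup {a | f(x(a)) ≤ t(a)}`, possibly `∞`. -/
def alpha2 (f : E → EReal) (ebar : E) (fhat : ℝ) (x : E) (t : ℝ) : EReal :=
  sSup ((fun a : ℝ => (a : EReal)) ''
    {a : ℝ | f (lineX ebar x a) ≤ (lineT fhat t a : EReal)})

/-- `α(x, t) = min {α₁(x), α₂(x, t)}`, which is finite and positive when `A x = b`, `t < f̂`. -/
def alpha (f : E → EReal) (S : Set E) (ebar : E) (fhat : ℝ) (x : E) (t : ℝ) : ℝ :=
  (min (alpha1 S ebar x) (alpha2 f ebar fhat x t)).toReal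

/-- `π'(x, t) = (ē, f̂) + α(x, t) ((x, t) - (ē, f̂))`. -/
def radialProj (f : E → EReal) (S : Set E) (ebar : E) (fhat : ℝ) (x : E) (t : ℝ) : E × ℝ :=
  (ebar, fhat) + alpha f S ebar fhat x t • ((x, t) - (ebar, fhat))

/-- Normal cone to `S` at `x'`. -/
def normalCone (S : Set E) (x' : E) : Set E :=
  {v | ∀ x ∈ S, ⟪v, x - x'⟫ ≤ 0}

/-- Normal cone to a subset of `E × ℝ` at `p'`, with respect to the inner product
`⟨x₁, x₂⟩ + t₁ t₂`. -/
def normalConeProd (C : Set (E × ℝ)) (p' : E × ℝ) : Set (E × ℝ) :=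
  {w | ∀ p ∈ C, ⟪w.1, p.1 - p'.1⟫ + w.2 * (p.2 - p'.2) ≤ 0}

/-- `G₁(x') = {(-1 / ⟨v, ē - x'⟩) v | 0 ≠ v ∈ N_S(x')}`. -/
def G1 (S : Set E) (ebar x' : E) : Set E :=
  {g | ∃ v ∈ normalCone S x', v ≠ 0 ∧ g = (-1 / ⟪v, ebar - x'⟫) • v}

/-- `G₂(x', t') = {(-1 / (⟨v, ē - x'⟩ + (f̂ - t') δ)) v | 0 ≠ (v, δ) ∈ N_{epi f}(x', t')}`. -/
def G2 (f : E → EReal) (ebar : E) (fhat : ℝ) (p' : E × ℝ) : Set E :=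
  {g | ∃ w ∈ normalConeProd (epi f) p', w ≠ 0 ∧
    g = (-1 / (⟪w.1, ebar - p'.1⟫ + (fhat - p'.2) * w.2)) • w.1}

/-- `bdy₁ = {(x', t') | x' ∈ bdy S}`. -/
def bdy1 (S : Set E) : Set (E × ℝ) := {p' | p'.1 ∈ frontier S}

/-- `bdy₂ = bdy (epi f)`. -/
def bdy2 (f : E → EReal) : Set (E × ℝ) := frontier (epi f)

open Classical in
/-- The set `G(x', t')` for `(x', t') ∈ bdy₁ ∪ bdy₂` (and the empty set elsewhere). -/
def G (f : E → EReal) (S : Set E) (ebar : E) (fhat : ℝ) (p' : E × ℝ) : Set E :=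
  if p' ∈ bdy1 S \ bdy2 f then G1 S ebar p'.1
  else if p' ∈ bdy2 f \ bdy1 S then G2 f ebar fhat p'
  else if p' ∈ bdy1 S ∩ bdy2 f then convexHull ℝ (G1 S ebar p'.1 ∪ G2 f ebar fhat p')
  else ∅

/-- Orthogonal projection onto the kernel of `A`. -/
def P (A : E →ₗ[ℝ] F) (g : E) : E := (LinearMap.ker A).starProjection g

/-- `x`, `(x', t')`, `α` and `g` are sequences generated by Algorithm B, where `g k` is the element
of `G(x'_k, t'_k)` chosen (arbitrarily) in iteration `k`. -/
structure IsRun (f : E → EReal) (S : Set E) (A : E →ₗ[ℝ] F) (b : F) (ebar : E) (fhat : ℝ)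
    (x x' : ℕ → E) (t' α : ℕ → ℝ) (g : ℕ → E) : Prop where
  init_x : x 0 = ebar
  init_proj : x' 0 = ebar ∧ t' 0 = (f ebar).toReal
  init_alpha : α 0 = alpha f S ebar fhat (x 0) (fstar f S A b)
  choose_g : ∀ k, g k ∈ G f S ebar fhat (x' k, t' k)
  step_x : ∀ k, x (k + 1) = x k + ((α k - 1) / (α k * ‖P A (g k)‖ ^ 2)) • P A (g k)
  step_proj : ∀ k,
    (x' (k + 1), t' (k + 1)) = radialProj f S ebar fhat (x (k + 1)) (fstar f S A b)
  step_alpha : ∀ k, α (k + 1) = alpha f S ebar fhat (x (k + 1)) (fstar f S A b)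

end AlgorithmB

end

/-!
Write `p = (ē, f̂)`, an interior point of the closed convex set `K = {(x, t) ∈ epi f | x ∈ S}`.
An element `g` of `G(x', t')` extends to a functional `ψ` on `E × ℝ` with `ψ (q - p) ≤ 1` for
`q ∈ K` and equality at `(x', t')`. As `(x'ₖ, t'ₖ) = p + αₖ ((xₖ, f*) - p)`, comparing `ψ` at
`(xₖ, f*)` and at `(z, f*)`, for a minimizer `z`, gives `⟪P gₖ, xₖ - z⟫ ≥ dₖ`, where
`dₖ = 1 / αₖ - 1`, while the bound for `ψ` on the points `(x, f̂)` with `‖x - ē‖ ≤ r̂` and `A x = b`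
gives `r̂ ‖P gₖ‖ ≤ 1`. The iteration is therefore the subgradient method with Polyak's step size:
`‖xₖ - z‖²` drops by at least `(r̂ dₖ)²` in each step, and some `k ≤ ℓ` has
`(ℓ + 1) (r̂ dₖ)² ≤ D̄²`. The relative optimality gap at `x'ₖ` is at most `1 - αₖ`.
-/

open scoped Topology

namespace AlgorithmB

open Set Filter

section Polyak

variable {H : Type*} [NormedAddCommGroup H] [InnerProductSpace ℝ H]

lemma norm_polyak_step_sq_add_le {u q : H} {d r : ℝ} (hd : 0 ≤ d) (hr : 0 ≤ r)
    (hq : r * ‖q‖ ≤ 1) (hu : d ≤ ⟪q, u⟫) :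
    ‖u - (d / ‖q‖ ^ 2) • q‖ ^ 2 + (r * d) ^ 2 ≤ ‖u‖ ^ 2 := by
  rcases eq_or_ne q 0 with rfl | hq0
  · obtain rfl : d = 0 := le_antisymm (by simpa using hu) hd
    simp
  have hn : 0 < ‖q‖ := norm_pos_iff.2 hq0
  have hrd : r * d ≤ d / ‖q‖ := by
    rw [le_div_iff₀ hn]
    nlinarith
  have hinner : d / ‖q‖ ^ 2 * d ≤ d / ‖q‖ ^ 2 * ⟪q, u⟫ := by gcongr
  calc ‖u - (d / ‖q‖ ^ 2) • q‖ ^ 2 + (r * d) ^ 2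
      ≤ ‖u - (d / ‖q‖ ^ 2) • q‖ ^ 2 + (d / ‖q‖) ^ 2 := by gcongr
    _ = ‖u‖ ^ 2 + 2 * (d / ‖q‖ ^ 2 * d - d / ‖q‖ ^ 2 * ⟪q, u⟫) := by
      rw [norm_sub_sq_real, inner_smul_right, real_inner_comm, norm_smul, Real.norm_of_nonneg
        (by positivity)]
      field_simp
      ring
    _ ≤ ‖u‖ ^ 2 := by linarith

lemma norm_sq_add_sum_polyak_le {u q : ℕ → H} {z : H} {d : ℕ → ℝ} {r : ℝ} (hr : 0 ≤ r)
    (hd : ∀ k, 0 ≤ d k) (hq : ∀ k, r * ‖q k‖ ≤ 1) (hinner : ∀ k, d k ≤ ⟪q k, u k - z⟫)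
    (hstep : ∀ k, u (k + 1) = u k - (d k / ‖q k‖ ^ 2) • q k) (n : ℕ) :
    ‖u n - z‖ ^ 2 + ∑ k ∈ Finset.range n, (r * d k) ^ 2 ≤ ‖u 0 - z‖ ^ 2 := by
  induction n with
  | zero => simp
  | succ n ih =>
    have h := norm_polyak_step_sq_add_le (hd n) hr (hq n) (hinner n)
    rw [sub_right_comm, ← hstep] at h
    rw [Finset.sum_range_succ]
    linarith

lemma exists_polyak_sq_le {u q : ℕ → H} {z : H} {d : ℕ → ℝ} {r : ℝ} (hr : 0 ≤ r)
    (hd : ∀ k, 0 ≤ d k) (hq : ∀ k, r * ‖q k‖ ≤ 1) (hinner : ∀ k, d k ≤ ⟪q k, u k - z⟫)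
    (hstep : ∀ k, u (k + 1) = u k - (d k / ‖q k‖ ^ 2) • q k) (l : ℕ) :
    ∃ k ≤ l, (l + 1) * (r * d k) ^ 2 ≤ ‖u 0 - z‖ ^ 2 := by
  have hsum : ∑ k ∈ Finset.range (l + 1), (r * d k) ^ 2 ≤
      ∑ _k ∈ Finset.range (l + 1), ‖u 0 - z‖ ^ 2 / (l + 1) := by
    have h := norm_sq_add_sum_polyak_le hr hd hq hinner hstep (l + 1)
    rw [Finset.sum_const, Finset.card_range, nsmul_eq_mul, Nat.cast_succ,
      mul_div_cancel₀ _ (by positivity)]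
    linarith [sq_nonneg ‖u (l + 1) - z‖]
  obtain ⟨k, hk, hle⟩ := Finset.exists_le_of_sum_le Finset.nonempty_range_add_one hsum
  refine ⟨k, Finset.mem_range_succ_iff.1 hk, ?_⟩
  rwa [le_div_iff₀' (by positivity)] at hle

end Polyak

section SupportFunctionals

variable {V : Type*} [AddCommGroup V] [Module ℝ V] [TopologicalSpace V]

/-- The continuous linear functionals that support `C` at `p'`, normalized with respect to the
reference point `p`: they are at most `1` on `C - p`, with value `1` at `p' - p`. -/
def supportFunctionals (C : Set V) (p p' : V) : Set (StrongDual ℝ V) :=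
  {ψ | (∀ q ∈ C, ψ (q - p) ≤ 1) ∧ ψ (p' - p) = 1}

lemma supportFunctionals_anti {C C' : Set V} (h : C ⊆ C') (p p' : V) :
    supportFunctionals C' p p' ⊆ supportFunctionals C p p' :=
  fun _ hψ => ⟨fun q hq => hψ.1 q (h hq), hψ.2⟩

lemma apply_lt_of_mem_interior [ContinuousAdd V] [ContinuousSMul ℝ V] {φ : StrongDual ℝ V}
    (hφ : φ ≠ 0) {C : Set V} {c : ℝ} (hC : ∀ q ∈ C, φ q ≤ c) {p : V} (hp : p ∈ interior C) :
    φ p < c := by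
  have h : φ '' interior C ⊆ interior (Iic c) :=
    interior_maximal (image_subset_iff.2 fun q hq => hC q (interior_subset hq))
      (φ.isOpenMap_of_ne_zero hφ _ isOpen_interior)
  rw [interior_Iic] at h
  exact h (mem_image_of_mem φ hp)

lemma smul_mem_supportFunctionals [ContinuousAdd V] [ContinuousSMul ℝ V] {φ : StrongDual ℝ V}
    (hφ : φ ≠ 0) {C : Set V} {p p' : V} (hC : ∀ q ∈ C, φ (q - p') ≤ 0) (hp : p ∈ interior C) :
    (-1 / φ (p - p')) • φ ∈ supportFunctionals C p p' := by
  have hneg : φ (p - p') < 0 := by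
    rw [map_sub, sub_neg]
    exact apply_lt_of_mem_interior hφ (fun q hq => by simpa using hC q hq) hp
  refine ⟨fun q hq => ?_, ?_⟩
  · rw [smul_apply, smul_eq_mul, div_mul_eq_mul_div, div_le_one_of_neg hneg,
      ← sub_sub_sub_cancel_right q p p', map_sub φ (q - p')]
    linarith [hC q hq]
  · rw [smul_apply, smul_eq_mul, ← neg_sub p p', map_neg, div_mul_eq_mul_div, neg_one_mul, neg_neg,
      div_self hneg.ne]

lemma inv_sub_one_le_of_mem_supportFunctionals {C : Set V} {p q z : V} {a : ℝ}
    {ψ : StrongDual ℝ V} (hψ : ψ ∈ supportFunctionals C p (AffineMap.lineMap p q a))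
    (hz : z ∈ C) : a⁻¹ - 1 ≤ ψ (q - z) := by
  have hq : a * ψ (q - p) = 1 := by
    simpa [AffineMap.lineMap_apply_module'] using hψ.2
  rw [← sub_sub_sub_cancel_right q z p, map_sub, ← eq_inv_of_mul_eq_one_right hq]
  linarith [hψ.1 z hz]

end SupportFunctionals

section InnerProduct

variable {E : Type*} [NormedAddCommGroup E] [InnerProductSpace ℝ E]

/-- The functional `(x, t) ↦ ⟪w.1, x⟫ + w.2 * t` on `E × ℝ`. The norm of `E × ℝ` is not induced by
this pairing, so it is not an instance of `innerSL`. -/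
noncomputable def pairing (w : E × ℝ) : StrongDual ℝ (E × ℝ) :=
  (innerSL ℝ w.1).coprod (w.2 • ContinuousLinearMap.id ℝ ℝ)

lemma pairing_apply (w q : E × ℝ) : pairing w q = ⟪w.1, q.1⟫ + w.2 * q.2 := by
  simp [pairing]

lemma pairing_ne_zero {w : E × ℝ} (hw : w ≠ 0) : pairing w ≠ 0 := by
  contrapose! hw
  have h1 : ⟪w.1, w.1⟫ = 0 := by simpa [pairing_apply] using DFunLike.congr_fun hw (w.1, 0)
  have h2 : w.2 = 0 := by simpa [pairing_apply] using DFunLike.congr_fun hw (0, 1)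
  exact Prod.ext (inner_self_eq_zero.1 h1) h2

/-- The first components of the normalized support functionals of `C ⊆ E × ℝ` at `p'`. -/
def supportGradients (C : Set (E × ℝ)) (p p' : E × ℝ) : Set E :=
  {g | ∃ ψ ∈ supportFunctionals C p p', ∀ u, ψ (u, 0) = ⟪g, u⟫}

lemma supportGradients_anti {C C' : Set (E × ℝ)} (h : C ⊆ C') (p p' : E × ℝ) :
    supportGradients C' p p' ⊆ supportGradients C p p' :=
  fun _ ⟨ψ, hψ, hg⟩ => ⟨ψ, supportFunctionals_anti h p p' hψ, hg⟩

lemma convex_supportGradients (C : Set (E × ℝ)) (p p' : E × ℝ) :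
    Convex ℝ (supportGradients C p p') := by
  rintro g₁ ⟨ψ₁, ⟨hle₁, heq₁⟩, hg₁⟩ g₂ ⟨ψ₂, ⟨hle₂, heq₂⟩, hg₂⟩ a c ha hc hac
  refine ⟨a • ψ₁ + c • ψ₂, ⟨fun q hq => ?_, ?_⟩, fun u => ?_⟩
  · calc a * ψ₁ (q - p) + c * ψ₂ (q - p) ≤ a * 1 + c * 1 := by
          gcongr
          exacts [hle₁ q hq, hle₂ q hq]
      _ = 1 := by rw [mul_one, mul_one, hac]
  · simp [-map_sub, heq₁, heq₂, hac]
  · simp [hg₁, hg₂, inner_add_left, real_inner_smul_left]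

lemma smul_fst_mem_supportGradients {C : Set (E × ℝ)} {p p' w : E × ℝ} (hp : p ∈ interior C)
    (hw : w ∈ normalConeProd C p') (hw0 : w ≠ 0) :
    (-1 / (⟪w.1, p.1 - p'.1⟫ + (p.2 - p'.2) * w.2)) • w.1 ∈ supportGradients C p p' := by
  refine ⟨_, smul_mem_supportFunctionals (pairing_ne_zero hw0) (p' := p') (fun q hq => ?_) hp,
    fun u => ?_⟩
  · rw [pairing_apply]
    exact hw q hq
  · simp [-map_sub, pairing_apply, real_inner_smul_left, mul_comm w.2]

end InnerProduct

section Projection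

variable {E F : Type*} [NormedAddCommGroup E] [InnerProductSpace ℝ E] [FiniteDimensional ℝ E]
  [AddCommGroup F] [Module ℝ F]

lemma map_P (A : E →ₗ[ℝ] F) (g : E) : A (P A g) = 0 :=
  LinearMap.mem_ker.1 ((LinearMap.ker A).starProjection_apply_mem g)

lemma inner_P_of_map_eq_zero (A : E →ₗ[ℝ] F) (g : E) {u : E} (hu : A u = 0) :
    ⟪P A g, u⟫ = ⟪g, u⟫ := by
  rw [P, Submodule.inner_starProjection_left_eq_right,
    Submodule.starProjection_eq_self_iff.2 (LinearMap.mem_ker.2 hu)]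

lemma mul_norm_P_le_one (A : E →ₗ[ℝ] F) (g : E) {r : ℝ}
    (h : ∀ u : E, ‖u‖ ≤ r → A u = 0 → ⟪g, u⟫ ≤ 1) : r * ‖P A g‖ ≤ 1 := by
  rcases lt_or_ge r 0 with hr | hr
  · nlinarith [norm_nonneg (P A g)]
  rcases (norm_nonneg (P A g)).eq_or_lt with hn | hn
  · simp [← hn]
  have hu := h ((r / ‖P A g‖) • P A g)
    (by rw [norm_smul, Real.norm_of_nonneg (by positivity), div_mul_cancel₀ _ hn.ne'])
    (by rw [map_smul, map_P, smul_zero])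
  rw [inner_smul_right, ← inner_P_of_map_eq_zero A g (map_P A g),
    real_inner_self_eq_norm_sq] at hu
  calc r * ‖P A g‖ = r / ‖P A g‖ * ‖P A g‖ ^ 2 := by field_simp
    _ ≤ 1 := hu

end Projection

section ConstrainedEpigraph

lemma isClosed_epi {X : Type*} [TopologicalSpace X] {f : X → EReal}
    (hf : LowerSemicontinuous f) : IsClosed (epi f) :=
  hf.isClosed_epigraph.preimage (f := fun p : X × ℝ => (p.1, (p.2 : EReal)))
    (continuous_fst.prodMk (continuous_coe_real_ereal.comp continuous_snd))

lemma mem_dom_of_le_coe {X : Type*} {f : X → EReal} {x : X} {t : ℝ} (h : f x ≤ t) :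
    x ∈ dom f :=
  (h.trans_lt (EReal.coe_lt_top t)).ne

/-- The part of the epigraph of `f` above `S`. -/
def constrainedEpi {X : Type*} (f : X → EReal) (S : Set X) : Set (X × ℝ) :=
  epi f ∩ Prod.fst ⁻¹' S

lemma convexOn_toReal {V : Type*} [AddCommGroup V] [Module ℝ V] {f : V → EReal}
    (hf_bot : ∀ x, f x ≠ ⊥) (hf_conv : Convex ℝ (epi f)) :
    ConvexOn ℝ (dom f) (fun x => (f x).toReal) := by
  have hle : ∀ x ∈ dom f, ∀ y ∈ dom f, ∀ a c : ℝ, 0 ≤ a → 0 ≤ c → a + c = 1 →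
      f (a • x + c • y) ≤ ((a * (f x).toReal + c * (f y).toReal : ℝ) : EReal) :=
    fun x hx y hy a c ha hc hac => hf_conv (x := (x, (f x).toReal)) (EReal.le_coe_toReal hx)
      (y := (y, (f y).toReal)) (EReal.le_coe_toReal hy) ha hc hac
  refine ⟨fun x hx y hy a c ha hc hac => mem_dom_of_le_coe (hle x hx y hy a c ha hc hac),
    fun x hx y hy a c ha hc hac => ?_⟩
  exact EReal.toReal_le_toReal (hle x hx y hy a c ha hc hac) (hf_bot _) (EReal.coe_ne_top _)

variable {E : Type*} [NormedAddCommGroup E] [InnerProductSpace ℝ E]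

lemma mem_interior_constrainedEpi [FiniteDimensional ℝ E] {f : E → EReal}
    (hf_bot : ∀ x, f x ≠ ⊥) (hf_conv : Convex ℝ (epi f)) {S : Set E} {e : E}
    (he : e ∈ interior (S ∩ dom f)) {c : ℝ} (hc : f e < c) :
    (e, c) ∈ interior (constrainedEpi f S) := by
  have hed : e ∈ interior (dom f) := interior_mono inter_subset_right he
  have hcont : ContinuousAt (fun x => (f x).toReal) e :=
    (convexOn_toReal hf_bot hf_conv).continuousOn_interior.continuousAt
      (isOpen_interior.mem_nhds hed)
  have hlt : (f e).toReal < c := by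
    rwa [← EReal.coe_lt_coe_iff, EReal.coe_toReal (interior_subset hed) (hf_bot e)]
  have hgap : ∀ᶠ p : E × ℝ in 𝓝 (e, c), (f p.1).toReal < p.2 :=
    ContinuousAt.eventually_lt (ContinuousAt.fst' hcont) continuousAt_snd hlt
  have hdom : ∀ᶠ p : E × ℝ in 𝓝 (e, c), p.1 ∈ S ∩ dom f :=
    continuousAt_fst.eventually (mem_interior_iff_mem_nhds.1 he)
  rw [mem_interior_iff_mem_nhds]
  filter_upwards [hgap, hdom] with p hp hpd
  refine ⟨?_, hpd.1⟩
  change f p.1 ≤ p.2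
  rw [← EReal.coe_toReal hpd.2 (hf_bot p.1)]
  exact EReal.coe_le_coe_iff.2 hp.le

lemma G1_subset_supportGradients {S : Set E} {e : E} {c : ℝ} (he : e ∈ interior S)
    (p' : E × ℝ) : G1 S e p'.1 ⊆ supportGradients (Prod.fst ⁻¹' S) (e, c) p' := by
  rintro _ ⟨v, hv, hv0, rfl⟩
  have h := smul_fst_mem_supportGradients (p := (e, c)) (p' := p') (w := (v, 0))
    (preimage_interior_subset_interior_preimage continuous_fst he)
    (fun q hq => by simpa using hv q.1 hq) (by simpa [Prod.ext_iff] using hv0)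
  simpa using h

lemma G_subset_supportGradients {f : E → EReal} {S : Set E} {ebar : E} {fhat : ℝ}
    (hp : (ebar, fhat) ∈ interior (constrainedEpi f S)) (p' : E × ℝ) :
    G f S ebar fhat p' ⊆ supportGradients (constrainedEpi f S) (ebar, fhat) p' := by
  have hpS : ebar ∈ interior S :=
    (isOpenMap_fst.interior_preimage_subset_preimage_interior
      (interior_mono inter_subset_right hp))
  have hpf : (ebar, fhat) ∈ interior (epi f) := interior_mono inter_subset_left hp
  have h1 : G1 S ebar p'.1 ⊆ supportGradients (constrainedEpi f S) (ebar, fhat) p' :=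
    (G1_subset_supportGradients hpS p').trans (supportGradients_anti inter_subset_right _ _)
  have h2 : G2 f ebar fhat p' ⊆ supportGradients (constrainedEpi f S) (ebar, fhat) p' := by
    rintro _ ⟨w, hw, hw0, rfl⟩
    exact supportGradients_anti inter_subset_left _ _ (smul_fst_mem_supportGradients hpf hw hw0)
  unfold G
  split_ifs
  · exact h1
  · exact h2
  · exact convexHull_min (union_subset h1 h2) (convex_supportGradients _ _ _)
  · exact empty_subset _

end ConstrainedEpigraph

section Alpha

lemma isGreatest_toReal_min_sSup {s t : Set ℝ} (hs : IsClosed s) (ht : IsClosed t)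
    (hs' : s.OrdConnected) (ht' : t.OrdConnected) (h0s : 0 ∈ s) (h0t : 0 ∈ t)
    (hbdd : BddAbove (s ∩ t)) :
    IsGreatest (s ∩ t) (EReal.toReal
      (min (sSup ((fun a : ℝ => (a : EReal)) '' s))
        (sSup ((fun a : ℝ => (a : EReal)) '' t)))) := by
  set m := min (sSup ((fun a : ℝ => (a : EReal)) '' s)) (sSup ((fun a : ℝ => (a : EReal)) '' t))
  have hle : ∀ a ∈ s ∩ t, (a : EReal) ≤ m := fun a ha =>
    le_min (le_sSup (mem_image_of_mem _ ha.1)) (le_sSup (mem_image_of_mem _ ha.2))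
  have hmem : ∀ a : ℝ, 0 ≤ a → (a : EReal) < m → a ∈ s ∩ t := by
    intro a ha ham
    obtain ⟨_, ⟨c, hc, rfl⟩, hac⟩ := lt_sSup_iff.1 (lt_min_iff.1 ham).1
    obtain ⟨_, ⟨d, hd, rfl⟩, had⟩ := lt_sSup_iff.1 (lt_min_iff.1 ham).2
    exact ⟨hs'.out h0s hc ⟨ha, EReal.coe_le_coe_iff.1 hac.le⟩,
      ht'.out h0t hd ⟨ha, EReal.coe_le_coe_iff.1 had.le⟩⟩
  have hub : ∀ B ∈ upperBounds (s ∩ t), m ≤ (B : EReal) := by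
    refine fun B hB => EReal.ge_of_forall_gt_iff_ge.1 fun a ha => EReal.coe_le_coe_iff.2 ?_
    rcases le_total a 0 with ha0 | ha0
    · exact ha0.trans (hB ⟨h0s, h0t⟩)
    · exact hB (hmem a ha0 ha)
  have hm : (m.toReal : EReal) = m := by
    obtain ⟨B, hB⟩ := hbdd
    exact EReal.coe_toReal ((hub B hB).trans_lt (EReal.coe_lt_top B)).ne
      ((EReal.bot_lt_coe 0).trans_le (hle 0 ⟨h0s, h0t⟩)).ne'
  have hlub : IsLUB (s ∩ t) m.toReal := by
    refine ⟨fun a ha => ?_, fun B hB => ?_⟩ <;> rw [← EReal.coe_le_coe_iff, hm]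
    exacts [hle a ha, hub B hB]
  exact ⟨hlub.mem_of_isClosed ⟨0, h0s, h0t⟩ (hs.inter ht), hlub.1⟩

lemma ordConnected_preimage_lineMap {V : Type*} [AddCommGroup V] [Module ℝ V] {C : Set V}
    (hC : Convex ℝ C) (p q : V) :
    (AffineMap.lineMap p q ⁻¹' C : Set ℝ).OrdConnected :=
  (hC.affine_preimage _).ordConnected

lemma exists_pos_lineMap_mem {V : Type*} [AddCommGroup V] [Module ℝ V] [TopologicalSpace V]
    [IsTopologicalAddGroup V] [ContinuousSMul ℝ V] {C : Set V} {p : V} (hp : p ∈ interior C)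
    (q : V) : ∃ a : ℝ, 0 < a ∧ AffineMap.lineMap p q a ∈ C := by
  have h : ∀ᶠ a in 𝓝 (0 : ℝ), AffineMap.lineMap p q a ∈ C :=
    AffineMap.lineMap_continuous.continuousAt.preimage_mem_nhds
      (by simpa using mem_interior_iff_mem_nhds.1 hp)
  obtain ⟨a, haC, ha⟩ :=
    ((h.filter_mono nhdsWithin_le_nhds).and (self_mem_nhdsWithin (s := Ioi (0 : ℝ)))).exists
  exact ⟨a, ha, haC⟩

variable {E : Type*} [NormedAddCommGroup E] [InnerProductSpace ℝ E]

lemma lineX_eq_lineMap (ebar x : E) : lineX ebar x = AffineMap.lineMap ebar x := by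
  ext a
  rw [lineX, AffineMap.lineMap_apply_module', add_comm]

lemma mk_lineX_lineT (ebar x : E) (fhat t a : ℝ) :
    (lineX ebar x a, lineT fhat t a) = AffineMap.lineMap (ebar, fhat) (x, t) a := by
  simp [AffineMap.lineMap_apply_module', lineX, lineT, add_comm]

lemma radialProj_eq_lineMap (f : E → EReal) (S : Set E) (ebar : E) (fhat : ℝ) (x : E) (t : ℝ) :
    radialProj f S ebar fhat x t =
      AffineMap.lineMap (ebar, fhat) (x, t) (alpha f S ebar fhat x t) := by
  rw [radialProj, AffineMap.lineMap_apply_module', add_comm]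

lemma isGreatest_alpha {f : E → EReal} (hf_lsc : LowerSemicontinuous f)
    (hf_conv : Convex ℝ (epi f)) {S : Set E} (hS_closed : IsClosed S) (hS_conv : Convex ℝ S)
    {ebar : E} {fhat : ℝ} (hp : (ebar, fhat) ∈ constrainedEpi f S) {x : E} {t : ℝ}
    (hbdd : BddAbove (AffineMap.lineMap (ebar, fhat) (x, t) ⁻¹' constrainedEpi f S : Set ℝ)) :
    IsGreatest (AffineMap.lineMap (ebar, fhat) (x, t) ⁻¹' constrainedEpi f S)
      (alpha f S ebar fhat x t) := by
  have hS : {a : ℝ | lineX ebar x a ∈ S} = AffineMap.lineMap ebar x ⁻¹' S := by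
    rw [← lineX_eq_lineMap]
    rfl
  have hf : {a : ℝ | f (lineX ebar x a) ≤ lineT fhat t a} =
      AffineMap.lineMap (ebar, fhat) (x, t) ⁻¹' epi f := by
    ext a
    rw [mem_preimage, ← mk_lineX_lineT]
    rfl
  have hinter : (AffineMap.lineMap ebar x ⁻¹' S ∩
      AffineMap.lineMap (ebar, fhat) (x, t) ⁻¹' epi f : Set ℝ) =
      AffineMap.lineMap (ebar, fhat) (x, t) ⁻¹' constrainedEpi f S := by
    ext a
    simp [constrainedEpi, AffineMap.fst_lineMap, and_comm]
  rw [alpha, alpha1, alpha2, hS, hf, ← hinter]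
  exact isGreatest_toReal_min_sSup (hS_closed.preimage AffineMap.lineMap_continuous)
    ((isClosed_epi hf_lsc).preimage AffineMap.lineMap_continuous)
    (ordConnected_preimage_lineMap hS_conv _ _) (ordConnected_preimage_lineMap hf_conv _ _)
    (by simpa using hp.2) (by simpa using hp.1) (by rwa [hinter])

end Alpha

section Minimizer

variable {E F : Type*} [NormedAddCommGroup E] [InnerProductSpace ℝ E] [AddCommGroup F] [Module ℝ F]

lemma isClosed_feas [FiniteDimensional ℝ E] {S : Set E} (hS : IsClosed S) (A : E →ₗ[ℝ] F)
    {b : F} {e : E} (he : A e = b) : IsClosed (feas S A b) := by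
  have h : {x : E | A x = b} = (fun x => x - e) ⁻¹' (LinearMap.ker A : Set E) := by
    ext x
    simp [sub_eq_zero, he]
  have hA : IsClosed {x : E | A x = b} := by
    rw [h]
    exact (LinearMap.ker A).closed_of_finiteDimensional.preimage (by fun_prop)
  exact hS.inter hA

lemma exists_isMinOn_feas [FiniteDimensional ℝ E] {f : E → EReal} (hf : LowerSemicontinuous f)
    {S : Set E} (hS : IsClosed S) {A : E →ₗ[ℝ] F} {b : F} {e : E} (he : e ∈ feas S A b)
    (hbdd : Bornology.IsBounded (sublevel f S A b e)) :
    ∃ z ∈ sublevel f S A b e, IsMinOn f (feas S A b) z := by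
  have hcompact : IsCompact (sublevel f S A b e) := Metric.isCompact_of_isClosed_isBounded
    ((isClosed_feas hS A he.2).inter (hf.isClosed_preimage (f e))) hbdd
  have hne : (sublevel f S A b e).Nonempty := ⟨e, he, le_rfl⟩
  obtain ⟨z, hz, hmin⟩ := (hf.lowerSemicontinuousOn _).exists_isMinOn hne hcompact
  refine ⟨z, hz, fun y hy => ?_⟩
  rcases le_total (f y) (f e) with h | h
  · exact hmin ⟨hy, h⟩
  · exact hz.2.trans h

lemma coe_fstar_of_isMinOn {f : E → EReal} {S : Set E} {A : E →ₗ[ℝ] F} {b : F} {z : E}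
    (hz : z ∈ feas S A b) (hmin : IsMinOn f (feas S A b) z) (hbot : f z ≠ ⊥) (htop : f z ≠ ⊤) :
    (fstar f S A b : EReal) = f z := by
  have h : ⨅ y ∈ feas S A b, f y = f z := le_antisymm (iInf₂_le z hz) (le_iInf₂ hmin)
  rw [fstar, h, EReal.coe_toReal htop hbot]

end Minimizer

section Radii

/-- The set of radii whose supremum is `rhat`. -/
def safeRadii {E F : Type*} [NormedAddCommGroup E] [InnerProductSpace ℝ E] [AddCommGroup F]
    [Module ℝ F] (f : E → EReal) (S : Set E) (A : E →ₗ[ℝ] F) (b : F) (ebar : E) (fhat : ℝ) :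
    Set ℝ :=
  {r | ∀ x : E, ‖x - ebar‖ ≤ r → A x = b → x ∈ S ∧ f x ≤ (fhat : EReal)}

variable {E F : Type*} [NormedAddCommGroup E] [InnerProductSpace ℝ E]
  [AddCommGroup F] [Module ℝ F] {f : E → EReal} {S : Set E} {A : E →ₗ[ℝ] F} {b : F} {ebar : E}
  {fhat : ℝ}

lemma exists_pos_mem_safeRadii (A : E →ₗ[ℝ] F) (b : F)
    (hp : (ebar, fhat) ∈ interior (constrainedEpi f S)) :
    ∃ r ∈ safeRadii f S A b ebar fhat, 0 < r := by
  have hnhds : ∀ᶠ x in 𝓝 ebar, (x, fhat) ∈ constrainedEpi f S :=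
    (Continuous.prodMk_left fhat).continuousAt.eventually (mem_interior_iff_mem_nhds.1 hp)
  obtain ⟨r, hr, hball⟩ := Metric.nhds_basis_closedBall.eventually_iff.1 hnhds
  exact ⟨r, fun x hx _ => (hball (mem_closedBall_iff_norm.2 hx)).symm, hr⟩

lemma rhat_nonneg (A : E →ₗ[ℝ] F) (b : F)
    (hp : (ebar, fhat) ∈ interior (constrainedEpi f S)) : 0 ≤ rhat f S A b ebar fhat :=
  have ⟨r, hr, hr0⟩ := exists_pos_mem_safeRadii A b hp
  Real.sSup_nonneg' ⟨r, hr, hr0.le⟩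

variable [FiniteDimensional ℝ E] {p' : E × ℝ} {g : E}

lemma mul_norm_P_le_one_of_mem_safeRadii (hA : A ebar = b)
    (hg : g ∈ supportGradients (constrainedEpi f S) (ebar, fhat) p') {r : ℝ}
    (hr : r ∈ safeRadii f S A b ebar fhat) : r * ‖P A g‖ ≤ 1 := by
  obtain ⟨ψ, ⟨hψ, -⟩, hψg⟩ := hg
  refine mul_norm_P_le_one A g fun u hu hAu => ?_
  obtain ⟨hS, hf⟩ := hr (ebar + u) (by simpa using hu) (by simp [hA, hAu])
  simpa [-map_sub, hψg] using hψ (ebar + u, fhat) ⟨hf, hS⟩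

lemma rhat_mul_norm_P_le_one (hA : A ebar = b)
    (hg : g ∈ supportGradients (constrainedEpi f S) (ebar, fhat) p') :
    rhat f S A b ebar fhat * ‖P A g‖ ≤ 1 := by
  rcases (norm_nonneg (P A g)).eq_or_lt with hn | hn
  · simp [← hn]
  rw [← le_div_iff₀ hn]
  exact Real.sSup_le (fun r hr => (le_div_iff₀ hn).2 (mul_norm_P_le_one_of_mem_safeRadii hA hg hr))
    (by positivity)

/-- When the safe radii are unbounded, `rhat` has the junk value `0`; this is excluded if some
projected gradient is nonzero. -/
lemma rhat_pos_of_P_ne_zero (hA : A ebar = b)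
    (hp : (ebar, fhat) ∈ interior (constrainedEpi f S))
    (hg : g ∈ supportGradients (constrainedEpi f S) (ebar, fhat) p') (hPg : P A g ≠ 0) :
    0 < rhat f S A b ebar fhat := by
  have hbdd : BddAbove (safeRadii f S A b ebar fhat) :=
    ⟨1 / ‖P A g‖, fun r hr =>
      (le_div_iff₀ (norm_pos_iff.2 hPg)).2 (mul_norm_P_le_one_of_mem_safeRadii hA hg hr)⟩
  obtain ⟨r, hr, hr0⟩ := exists_pos_mem_safeRadii A b hp
  exact hr0.trans_le (le_csSup hbdd hr)

end Radii

section Ray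

variable {E F : Type*} [NormedAddCommGroup E] [InnerProductSpace ℝ E]
  [AddCommGroup F] [Module ℝ F] {f : E → EReal} {S : Set E}

lemma map_lineMap_eq {A : E →ₗ[ℝ] F} {b : F} {e x : E} (he : A e = b) (hx : A x = b) (a : ℝ) :
    A (AffineMap.lineMap e x a) = b := by
  simp [AffineMap.lineMap_apply_module', he, hx]

lemma le_one_of_lineMap_mem {A : E →ₗ[ℝ] F} {b : F} {e x : E} (he : A e = b) (hx : A x = b)
    {c t : ℝ} (ht : ∀ y ∈ feas S A b, (t : EReal) ≤ f y) (htc : t < c) {a : ℝ}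
    (ha : AffineMap.lineMap (e, c) (x, t) a ∈ constrainedEpi f S) : a ≤ 1 := by
  rw [← mk_lineX_lineT] at ha
  have hfeas : lineX e x a ∈ feas S A b :=
    ⟨ha.2, by rw [lineX_eq_lineMap, map_lineMap_eq he hx]⟩
  have hle : t ≤ c + a * (t - c) := EReal.coe_le_coe_iff.1 ((ht _ hfeas).trans ha.1)
  nlinarith

lemma lineMap_preimage_constrainedEpi_self {e : E} (heS : e ∈ S) (hbot : f e ≠ ⊥)
    (hdom : e ∈ dom f) {c t : ℝ} (htc : t < c) :
    (AffineMap.lineMap (e, c) (e, t) ⁻¹' constrainedEpi f S : Set ℝ) =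
      Iic ((c - (f e).toReal) / (c - t)) := by
  ext a
  have hX : lineX e e a = e := by simp [lineX]
  rw [mem_preimage, ← mk_lineX_lineT, hX, mem_Iic, le_div_iff₀ (sub_pos.2 htc)]
  change f e ≤ lineT c t a ∧ e ∈ S ↔ _
  rw [← EReal.coe_toReal hdom hbot, EReal.coe_le_coe_iff, EReal.toReal_coe, lineT]
  constructor
  · rintro ⟨h, -⟩
    linarith
  · exact fun h => ⟨by linarith, heS⟩

lemma relative_gap_le {e x y : E} (hbot : f y ≠ ⊥) {c t s a : ℝ} (htc : t < c) (hy : f y ≤ s)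
    (hs : (y, s) = AffineMap.lineMap (e, c) (x, t) a) :
    ((f y).toReal - t) / (c - t) ≤ 1 - a := by
  have hst : s = lineT c t a := congrArg Prod.snd (hs.trans (mk_lineX_lineT ..).symm)
  have h := EReal.toReal_le_toReal hy hbot (EReal.coe_ne_top _)
  rw [EReal.toReal_coe, hst, lineT] at h
  rw [div_le_iff₀ (sub_pos.2 htc)]
  linarith

end Ray

section Bounds

lemma mul_le_one_of_sq_le {D r d s n : ℝ} (hn : 0 < n) (hr : 0 < r)
    (hd : n * (r * d) ^ 2 ≤ D ^ 2) (hs : (D / r * s) ^ 2 ≤ n) : d * s ≤ 1 := by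
  have h : n * (d * s) ^ 2 ≤ n * 1 := by
    calc n * (d * s) ^ 2 = n * (r * d) ^ 2 * (s / r) ^ 2 := by field_simp
      _ ≤ D ^ 2 * (s / r) ^ 2 := by gcongr
      _ = (D / r * s) ^ 2 := by ring
      _ ≤ n * 1 := by rwa [mul_one]
  exact (abs_le.1 ((sq_le_one_iff_abs_le_one _).1 (le_of_mul_le_mul_left h hn))).2

lemma one_sub_le_of_mul_le_one {a ε : ℝ} (ha : 0 < a) (hε : 0 < ε)
    (h : (a⁻¹ - 1) * ((1 - ε) / ε) ≤ 1) : 1 - a ≤ ε := by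
  have h' : (1 - a) * (1 - ε) ≤ a * ε := by
    calc (1 - a) * (1 - ε) = a * ε * ((a⁻¹ - 1) * ((1 - ε) / ε)) := by field_simp
      _ ≤ a * ε := mul_le_of_le_one_right (by positivity) h
  linarith

lemma sq_le_add_one_of_iteration_bound {ρ s n : ℝ} (hs : 0 < s) (hn : 0 ≤ n)
    (h : 4 * ρ ^ 2 * (4 / 3 * s ^ 2 + 4 * s + Real.logb 2 s + Real.logb 2 ρ + 1) ≤ n) :
    (ρ * s) ^ 2 ≤ n + 1 := by
  rcases le_or_gt |ρ * s| 1 with hle | hgt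
  · linarith [(sq_le_one_iff_abs_le_one (ρ * s)).2 hle]
  have hρ : ρ ≠ 0 := left_ne_zero_of_mul (abs_pos.1 (one_pos.trans hgt))
  have hlog : 0 ≤ Real.logb 2 s + Real.logb 2 ρ := by
    rw [← Real.logb_mul hs.ne' hρ, mul_comm, ← Real.logb_abs]
    exact Real.logb_nonneg one_lt_two hgt.le
  calc (ρ * s) ^ 2 = 4 * ρ ^ 2 * (s ^ 2 / 4) := by ring
    _ ≤ 4 * ρ ^ 2 * (4 / 3 * s ^ 2 + 4 * s + Real.logb 2 s + Real.logb 2 ρ + 1) := by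
      gcongr
      linarith [sq_nonneg s]
    _ ≤ n + 1 := by linarith

end Bounds

section Run

variable {E F : Type*} [NormedAddCommGroup E] [InnerProductSpace ℝ E] [FiniteDimensional ℝ E]
  [AddCommGroup F] [Module ℝ F] {f : E → EReal} {S : Set E} {A : E →ₗ[ℝ] F} {b : F} {ebar : E}
  {fhat : ℝ} {x x' : ℕ → E} {t' α : ℕ → ℝ} {g : ℕ → E}

namespace IsRun

lemma map_x (hrun : IsRun f S A b ebar fhat x x' t' α g) (hA : A ebar = b) (k : ℕ) :
    A (x k) = b := by
  induction k with
  | zero => rw [hrun.init_x, hA]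
  | succ k ih => rw [hrun.step_x, map_add, map_smul, map_P, smul_zero, add_zero, ih]

lemma α_eq (hrun : IsRun f S A b ebar fhat x x' t' α g) :
    ∀ k, α k = alpha f S ebar fhat (x k) (fstar f S A b)
  | 0 => hrun.init_alpha
  | k + 1 => hrun.step_alpha k

lemma isGreatest_α (hrun : IsRun f S A b ebar fhat x x' t' α g) (hA : A ebar = b)
    (hf_lsc : LowerSemicontinuous f) (hf_conv : Convex ℝ (epi f)) (hS_closed : IsClosed S)
    (hS_conv : Convex ℝ S) (hp : (ebar, fhat) ∈ constrainedEpi f S)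
    (hmin : ∀ y ∈ feas S A b, (fstar f S A b : EReal) ≤ f y) (hlt : fstar f S A b < fhat)
    (k : ℕ) :
    IsGreatest (AffineMap.lineMap (ebar, fhat) (x k, fstar f S A b) ⁻¹' constrainedEpi f S)
      (α k) := by
  rw [hrun.α_eq k]
  exact isGreatest_alpha hf_lsc hf_conv hS_closed hS_conv hp
    ⟨1, fun a ha => le_one_of_lineMap_mem hA (hrun.map_x hA k) hmin hlt ha⟩

lemma proj_eq_lineMap (hrun : IsRun f S A b ebar fhat x x' t' α g) (heS : ebar ∈ S)
    (hbot : f ebar ≠ ⊥) (hdom : ebar ∈ dom f) (hlt : fstar f S A b < fhat)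
    (hα : IsGreatest (AffineMap.lineMap (ebar, fhat) (x 0, fstar f S A b) ⁻¹' constrainedEpi f S)
      (α 0)) :
    ∀ k, (x' k, t' k) = AffineMap.lineMap (ebar, fhat) (x k, fstar f S A b) (α k)
  | 0 => by
    rw [hrun.init_x, lineMap_preimage_constrainedEpi_self heS hbot hdom hlt] at hα
    have hgap : fhat - fstar f S A b ≠ 0 := (sub_pos.2 hlt).ne'
    rw [← mk_lineX_lineT, hrun.init_x, hrun.init_proj.1, hrun.init_proj.2,
      hα.unique isGreatest_Iic, Prod.mk.injEq, lineX, lineT, sub_self, smul_zero, add_zero]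
    refine ⟨rfl, ?_⟩
    field_simp
    ring
  | k + 1 => by rw [hrun.step_proj, radialProj_eq_lineMap, hrun.step_alpha]

lemma step_polyak (hrun : IsRun f S A b ebar fhat x x' t' α g) {k : ℕ} (hα : α k ≠ 0) :
    x (k + 1) = x k - (((α k)⁻¹ - 1) / ‖P A (g k)‖ ^ 2) • P A (g k) := by
  have h : (α k - 1) / (α k * ‖P A (g k)‖ ^ 2) = -(((α k)⁻¹ - 1) / ‖P A (g k)‖ ^ 2) := by
    rw [← div_div, sub_div, div_self hα, one_div, ← neg_div, neg_sub]
  rw [hrun.step_x, h, neg_smul, ← sub_eq_add_neg]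

lemma inv_α_sub_one_le_inner (hrun : IsRun f S A b ebar fhat x x' t' α g) (hA : A ebar = b)
    {k : ℕ} (hproj : (x' k, t' k) = AffineMap.lineMap (ebar, fhat) (x k, fstar f S A b) (α k))
    (hg : g k ∈ supportGradients (constrainedEpi f S) (ebar, fhat) (x' k, t' k)) {z : E}
    (hz : z ∈ feas S A b) (hfz : f z ≤ fstar f S A b) :
    (α k)⁻¹ - 1 ≤ ⟪P A (g k), x k - z⟫ := by
  obtain ⟨ψ, hψ, hψg⟩ := hg
  rw [hproj] at hψ
  have h := inv_sub_one_le_of_mem_supportFunctionals hψ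
    (show (z, fstar f S A b) ∈ constrainedEpi f S from ⟨hfz, hz.1⟩)
  rwa [Prod.mk_sub_mk, sub_self, hψg,
    ← inner_P_of_map_eq_zero A (g k) (by rw [map_sub, hrun.map_x hA, hz.2, sub_self])] at h

lemma mem_feas (hrun : IsRun f S A b ebar fhat x x' t' α g) (hA : A ebar = b) {k : ℕ}
    (hproj : (x' k, t' k) = AffineMap.lineMap (ebar, fhat) (x k, fstar f S A b) (α k))
    (hmem : (x' k, t' k) ∈ constrainedEpi f S) : x' k ∈ feas S A b := by
  have hx' : x' k = AffineMap.lineMap ebar (x k) (α k) := by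
    simpa [AffineMap.fst_lineMap] using congrArg Prod.fst hproj
  exact ⟨hmem.2, by rw [hx', map_lineMap_eq hA (hrun.map_x hA k)]⟩

lemma exists_inv_α_sub_one_mul_le_one (hrun : IsRun f S A b ebar fhat x x' t' α g)
    (hA : A ebar = b) (hp : (ebar, fhat) ∈ interior (constrainedEpi f S))
    (hproj : ∀ k, (x' k, t' k) = AffineMap.lineMap (ebar, fhat) (x k, fstar f S A b) (α k))
    (hpos : ∀ k, 0 < α k) (hle : ∀ k, α k ≤ 1) {z : E} (hz : z ∈ feas S A b)
    (hfz : f z ≤ fstar f S A b) {D s : ℝ} (hD : ‖ebar - z‖ ≤ D) {l : ℕ}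
    (hl : (D / rhat f S A b ebar fhat * s) ^ 2 ≤ l + 1) :
    ∃ k ≤ l, ((α k)⁻¹ - 1) * s ≤ 1 := by
  have hg (k : ℕ) := G_subset_supportGradients hp _ (hrun.choose_g k)
  have hd (k : ℕ) : 0 ≤ (α k)⁻¹ - 1 := sub_nonneg.2 ((one_le_inv₀ (hpos k)).2 (hle k))
  have hinner (k : ℕ) := hrun.inv_α_sub_one_le_inner hA (hproj k) (hg k) hz hfz
  obtain ⟨k, hk, hsq⟩ := exists_polyak_sq_le (rhat_nonneg A b hp) hd
    (fun k => rhat_mul_norm_P_le_one hA (hg k)) hinner (fun k => hrun.step_polyak (hpos k).ne') l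
  refine ⟨k, hk, ?_⟩
  rcases eq_or_ne (P A (g k)) 0 with hP | hP
  · have h0 : (α k)⁻¹ - 1 = 0 := le_antisymm (by simpa [hP] using hinner k) (hd k)
    simp [h0]
  · rw [hrun.init_x] at hsq
    exact mul_le_one_of_sq_le (by positivity) (rhat_pos_of_P_ne_zero hA hp (hg k) hP)
      (hsq.trans (by gcongr)) hl

end IsRun

end Run

end AlgorithmB

open AlgorithmB in
theorem theorem1p2_general
    {E : Type*} [NormedAddCommGroup E] [InnerProductSpace ℝ E] [FiniteDimensional ℝ E]
    {F : Type*} [AddCommGroup F] [Module ℝ F]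
    (f : E → EReal) (hf_bot : ∀ x, f x ≠ ⊥) (hf_lsc : LowerSemicontinuous f)
    (hf_conv : Convex ℝ (epi f))
    (S : Set E) (hS_closed : IsClosed S) (hS_conv : Convex ℝ S)
    (A : E →ₗ[ℝ] F) (b : F)
    (ebar : E) (hebar : ebar ∈ interior (S ∩ dom f)) (hA : A ebar = b)
    (hbdd : Bornology.IsBounded (sublevel f S A b ebar))
    (fhat : ℝ) (hfhat : f ebar < (fhat : EReal))
    (x x' : ℕ → E) (t' α : ℕ → ℝ) (g : ℕ → E)
    (hrun : IsRun f S A b ebar fhat x x' t' α g) :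
    (∀ k, x' k ∈ feas S A b ∧ x' k ∈ dom f) ∧
    ∀ ε : ℝ, 0 < ε → ∀ l : ℕ,
      (Dbar f S A b ebar / rhat f S A b ebar fhat * ((1 - ε) / ε)) ^ 2 ≤ (l : ℝ) + 1 →
      ∃ k ≤ l, ((f (x' k)).toReal - fstar f S A b) / (fhat - fstar f S A b) ≤ ε := by
  obtain ⟨heS, hdom⟩ := interior_subset hebar
  have hp := mem_interior_constrainedEpi hf_bot hf_conv hebar hfhat
  obtain ⟨z, hz, hzmin⟩ := exists_isMinOn_feas hf_lsc hS_closed ⟨heS, hA⟩ hbdd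
  have hfz := coe_fstar_of_isMinOn hz.1 hzmin (hf_bot z) (hz.2.trans_lt hdom.lt_top).ne
  have hlt : fstar f S A b < fhat := by
    exact_mod_cast hfz.trans_lt (hz.2.trans_lt hfhat)
  have hmin (y : E) (hy : y ∈ feas S A b) := hfz.trans_le (hzmin hy)
  have hα := hrun.isGreatest_α hA hf_lsc hf_conv hS_closed hS_conv (interior_subset hp) hmin hlt
  have hproj := hrun.proj_eq_lineMap heS (hf_bot ebar) hdom hlt (hα 0)
  have hmem (k : ℕ) : (x' k, t' k) ∈ constrainedEpi f S := hproj k ▸ (hα k).1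
  have hpos (k : ℕ) : 0 < α k :=
    have ⟨_, ha, haK⟩ := exists_pos_lineMap_mem hp (x k, fstar f S A b)
    ha.trans_le ((hα k).2 haK)
  have hle (k : ℕ) : α k ≤ 1 := le_one_of_lineMap_mem hA (hrun.map_x hA k) hmin hlt (hα k).1
  refine ⟨fun k => ⟨hrun.mem_feas hA (hproj k) (hmem k), mem_dom_of_le_coe (hmem k).1⟩,
    fun ε hε l hl => ?_⟩
  have hD : ‖ebar - z‖ ≤ Dbar f S A b ebar := by
    rw [← dist_eq_norm]
    exact Metric.dist_le_diam_of_mem hbdd ⟨⟨heS, hA⟩, le_rfl⟩ hz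
  obtain ⟨k, hk, hαk⟩ :=
    hrun.exists_inv_α_sub_one_mul_le_one hA hp hproj hpos hle hz.1 hfz.ge hD hl
  exact ⟨k, hk, (relative_gap_le (hf_bot _) hlt (hmem k).1 (hproj k)).trans
    (one_sub_le_of_mul_le_one (hpos k) hε hαk)⟩

theorem theorem1p2
    {E : Type*} [NormedAddCommGroup E] [InnerProductSpace ℝ E] [FiniteDimensional ℝ E]
    {F : Type*} [AddCommGroup F] [Module ℝ F]
    (f : E → EReal) (hf_bot : ∀ x, f x ≠ ⊥) (hf_lsc : LowerSemicontinuous f)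
    (hf_conv : Convex ℝ (AlgorithmB.epi f))
    (S : Set E) (hS_closed : IsClosed S) (hS_conv : Convex ℝ S)
    (A : E →ₗ[ℝ] F) (b : F)
    (ebar : E) (hebar : ebar ∈ interior (S ∩ AlgorithmB.dom f)) (hA : A ebar = b)
    (hbdd : Bornology.IsBounded (AlgorithmB.sublevel f S A b ebar))
    (fhat : ℝ) (hfhat : f ebar < (fhat : EReal))
    (x x' : ℕ → E) (t' α : ℕ → ℝ) (g : ℕ → E)
    (hrun : AlgorithmB.IsRun f S A b ebar fhat x x' t' α g) :
    (∀ k, x' k ∈ AlgorithmB.feas S A b ∧ x' k ∈ AlgorithmB.dom f) ∧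
    ∀ ε : ℝ, 0 < ε → ε < 1 → ∀ l : ℕ,
      4 * (AlgorithmB.Dbar f S A b ebar / AlgorithmB.rhat f S A b ebar fhat) ^ 2 *
          (4 / 3 * ((1 - ε) / ε) ^ 2 + 4 * ((1 - ε) / ε) + Real.logb 2 ((1 - ε) / ε) +
            Real.logb 2 (AlgorithmB.Dbar f S A b ebar / AlgorithmB.rhat f S A b ebar fhat) + 1)
        ≤ (l : ℝ) →
      ∃ k ≤ l,
        ((f (x' k)).toReal - AlgorithmB.fstar f S A b) / (fhat - AlgorithmB.fstar f S A b) ≤ ε :=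
  by
  obtain ⟨hfeas, hgap⟩ := theorem1p2_general f hf_bot hf_lsc hf_conv S hS_closed hS_conv A b ebar
    hebar hA hbdd fhat hfhat x x' t' α g hrun
  exact ⟨hfeas, fun ε hε0 hε1 l hl => hgap ε hε0 l
    (AlgorithmB.sq_le_add_one_of_iteration_bound (div_pos (sub_pos.2 hε1) hε0) l.cast_nonneg hl)⟩
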